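/- Let $k$ be a field and let $A$ be a finite-dimensional $k$-algebra that is quasi-hereditary with respect to a finite poset $(\Lambda,\le)$. That is, let $L(\lambda)$ $(\lambda\in\Lambda)$ be a complete irredundant list of the simple $A$-modules up to isomorphism, let $P(\lambda)$ be the projective cover of $L(\lambda)$, and let the standard module $\Delta(\lambda)$ be the largest quotient of $P(\lambda)$ all of whose composition factors $L(\mu)$ satisfy $\mu\le\lambda$; then for every $\lambda$ all composition factors $L(\mu)$ of the kernel of $\Delta(\lambda)\to L(\lambda)$ satisfy $\mu<\lambda$, and the kernel of $P(\lambda)\to\Delta(\lambda)$ has a finite filtration whose sections are of the form $\Delta(\mu)$ with $\mu>\lambda$. Suppose that $A$ has a simple-preserving duality, i.e. a contravariant self-equivalence of the category of finite-dimensional $A$-modules which fixes every simple module up to isomorphism. Let the $\mathrm{Hom}$ quiver between standards be the quiver with vertex set labelled by the standard modules $\Delta(\lambda)$, $\lambda\in\Lambda$, and with $\dim_k\mathrm{Hom}_A(\Delta(\lambda),\Delta(\mu))$ arrows from $\lambda$ to $\mu$. Then the blocks of $A$ (given by the primitive central idempotents of $A$) may be identified with the connected components of this quiver: there is a bijection $\Phi$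 from the set of connected components (of the underlying undirected graph) onto the set of blocks of $A$ such that, for every $\lambda\in\Lambda$, the modules $L(\lambda)$, $\Delta(\lambda)$ and $P(\lambda)$ belong to the block $\Phi([\lambda])$, where $[\lambda]$ is the connected component containing $\lambda$ and a module belongs to a block if the corresponding idempotent acts on it as the identity. In particular, $L(\lambda)$ and $L(\mu)$ lie in the same block if and only if $\Delta(\lambda)$ and $\Delta(\mu)$ lie in the same connected component of the $\mathrm{Hom}$ quiver. -/

import Mathlib

open CategoryTheory

universe u v w

namespace QuasiHered

section Modules

variable (A : Type u) [Ring A]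

/-- The simple module `S` is a composition factor of `M`: it is isomorphic to a subquotient `V / U`
of `M`, where `U ≤ V` are submodules of `M`. -/
def IsCompFactor (M S : Type*) [AddCommGroup M] [Module A M] [AddCommGroup S] [Module A S] : Prop :=
  IsSimpleModule A S ∧
    ∃ U V : Submodule A M, U ≤ V ∧ Nonempty ((V ⧸ U.submoduleOf V) ≃ₗ[A] S)

/-- `P` is a projective cover of `S`: `P` is projective and there is a surjection `P → S` whose
kernel is superfluous. For simple `S` over a finite-dimensional algebra, this says that `P` is the
principal indecomposable module with head `S`. -/
def IsProjectiveCover (P S : Type*) [AddCommGroup P] [Module A P] [AddCommGroup S] [Module A S] :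
    Prop :=
  Module.Projective A P ∧ ∃ π : P →ₗ[A] S, Function.Surjective π ∧
    ∀ N : Submodule A P, N ⊔ LinearMap.ker π = ⊤ → N = ⊤

end Modules

section Weights

variable {A : Type u} [Ring A] {W : Type v}

/-- `L` is a complete and irredundant list of the simple `A`-modules up to isomorphism. -/
structure IsSimpleLabelling (L : W → ModuleCat.{u} A) : Prop where
  simple : ∀ l, IsSimpleModule A (L l)
  irredundant : ∀ l m, Nonempty (L l ≃ₗ[A] L m) → l = m
  complete : ∀ (S : Type u) [AddCommGroup S] [Module A S], IsSimpleModule A S →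
    ∃ l, Nonempty (S ≃ₗ[A] L l)

variable [PartialOrder W]

/-- The smallest submodule `U` of `P l` such that all composition factors `L m` of `P l / U`
satisfy `m ≤ l`. -/
def standardKernel (L P : W → ModuleCat.{u} A) (l : W) : Submodule A (P l) :=
  sInf {U | ∀ m, IsCompFactor A (P l ⧸ U) (L m) → m ≤ l}

/-- The standard module `Δ(l)`: the largest quotient of `P l` all of whose composition factors
`L m` satisfy `m ≤ l`. -/
abbrev standard (L P : W → ModuleCat.{u} A) (l : W) : ModuleCat.{u} A :=
  ModuleCat.of A (P l ⧸ standardKernel L P l)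

/-- `A` is quasi-hereditary with respect to the poset `W`, the simple modules `L l` and their
projective covers `P l`: the composition factors `L m` of the kernel of `Δ(l) → L l` have `m < l`,
and the kernel of `P l → Δ(l)` has a finite filtration whose sections are standard modules `Δ(m)`
with `m > l`. -/
structure IsQuasiHereditary (L P : W → ModuleCat.{u} A) : Prop where
  radical_lt : ∀ (l : W) (f : standard L P l →ₗ[A] L l), Function.Surjective f →
    ∀ m, IsCompFactor A (LinearMap.ker f) (L m) → m < l
  filtration : ∀ l : W, ∃ (n : ℕ) (F : ℕ → Submodule A (P l)),
    Monotone F ∧ F 0 = ⊥ ∧ F n = standardKernel L P l ∧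
      ∀ i < n, ∃ m, l < m ∧
        Nonempty ((F (i + 1) ⧸ (F i).submoduleOf (F (i + 1))) ≃ₗ[A] standard L P m)

end Weights

section Duality

variable (A : Type u) [Ring A]

/-- A duality on the category of finitely generated `A`-modules: a contravariant
self-equivalence. -/
abbrev Duality := (FGModuleCat.{u} A)ᵒᵖ ≌ FGModuleCat.{u} A

variable {A}

/-- The duality fixes every simple module up to isomorphism. -/
def Duality.SimplePreserving (D : Duality A) : Prop :=
  ∀ S : FGModuleCat.{u} A, IsSimpleModule A S →
    Nonempty (D.functor.obj (Opposite.op S) ≃ₗ[A] S)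

end Duality

section Blocks

/-- The blocks of `A`, given by the primitive central idempotents of `A` (the block itself, as a
two-sided ideal and an algebra, is `A e`). -/
def Block (A : Type u) [Ring A] : Type u :=
  {e : A // e ∈ Subring.center A ∧ IsIdempotentElem e ∧ e ≠ 0 ∧
    ∀ f ∈ Subring.center A, IsIdempotentElem f → f * e = f → f = 0 ∨ f = e}

/-- The module `M` belongs to the block `b`: the idempotent of `b` acts on `M` as the identity. -/
def Block.Contains {A : Type u} [Ring A] (b : Block A) (M : Type*) [AddCommGroup M] [Module A M] :
    Prop :=
  ∀ x : M, b.1 • x = x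

end Blocks

section HomQuiver

variable (k : Type w) [Field k] {A : Type u} [Ring A] [Algebra k A]
  {W : Type v} [PartialOrder W]

/-- The vertices of the `Hom` quiver between standards: the labels of the standard modules. -/
@[nolint unusedArguments]
def HomQuiver (_k : Type w) {A : Type u} [Ring A] {W : Type v} (_L _P : W → ModuleCat.{u} A) :
    Type v := W

/-- The number of arrows from `l` to `m` is the `k`-dimension of `Hom_A(Δ(l), Δ(m))`. -/
instance (L P : W → ModuleCat.{u} A) : Quiver (HomQuiver k L P) where
  Hom (l m : W) := Fin (Module.finrank k (standard L P l ⟶ standard L P m))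

/-- The connected component of the `Hom` quiver that contains the vertex `Δ(l)`. -/
def homComponent (L P : W → ModuleCat.{u} A) (l : W) :
    Quiver.WeaklyConnectedComponent (HomQuiver k L P) :=
  Quiver.WeaklyConnectedComponent.mk (show HomQuiver k L P from l)

end HomQuiver

end QuasiHered

namespace QuasiHered

/-! Composition factors are detected by projectives: `L l` occurs in `M` exactly when some map `P l
→ M` is nonzero. A nonzero map between standard modules forces equal blocks, so the block is
constant on each component of the `Hom` quiver. The content is the converse, that the components are
not finer than the blocks.

The duality yields a qualitative reciprocity (`exists_hom_standard_of_mem_filtration`): if `Δ(t)` is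
a section of `P l`, then `L l` occurs in `Δ(t)`. Well-founded induction on `t` then shows that every
composition factor `L l` of `Δ(t)` has `l` in the component of `t`
(`homComponent_eq_of_hom_standard`). A nonzero map `P l → P m` makes `L l` a factor of some section
`Δ(t)` of `P m`, and by reciprocity `L m` is one too, so `l` and `m` share a component.

Hence components are unions of linkage classes of projectives. Any such union is cut out by a
central idempotent (`exists_central_idempotent`), so different components lie in different blocks.
-/

/-- `L` is a complete irredundant list of simple modules, and `P l` is a projective cover of
`L l`. -/
structure IsProjectiveLabelling {A : Type u} [Ring A] {W : Type v} (L P : W → ModuleCat.{u} A) :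
    Prop where
  labelling : IsSimpleLabelling L
  cover : ∀ l, IsProjectiveCover A (P l) (L l)

/-! ### Projective covers, heads and composition factors. -/

namespace IsProjectiveLabelling

variable {A : Type u} [Ring A] {W : Type v} {L P : W → ModuleCat.{u} A}

theorem simple (h : IsProjectiveLabelling L P) (l : W) : IsSimpleModule A (L l) :=
  h.labelling.simple l

theorem exists_lift (h : IsProjectiveLabelling L P) {l : W} {M N : Type*} [AddCommGroup M]
    [Module A M] [AddCommGroup N] [Module A N] (g : M →ₗ[A] N) (hg : Function.Surjective g)
    (f : P l →ₗ[A] N) : ∃ f' : P l →ₗ[A] M, g ∘ₗ f' = f :=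
  have := (h.cover l).1
  Module.projective_lifting_property g f hg

/-- The head of `P l`: every proper submodule lies in the kernel of `P l → L l`. -/
theorem exists_head (h : IsProjectiveLabelling L P) (l : W) :
    ∃ π : P l →ₗ[A] L l, Function.Surjective π ∧
      ∀ N : Submodule A (P l), N ≠ ⊤ → N ≤ LinearMap.ker π := by
  obtain ⟨-, π, hπ, hN⟩ := h.cover l
  have := h.simple l
  refine ⟨π, hπ, fun N hNt => ?_⟩
  have hc := LinearMap.isCoatom_ker_of_surjective hπ
  by_contra hle
  refine hNt (hN N ?_)
  exact hc.2 _ (right_lt_sup.2 hle)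

theorem ker_head_ne_top (h : IsProjectiveLabelling L P) {l : W} {π : P l →ₗ[A] L l}
    (hπ : Function.Surjective π) : LinearMap.ker π ≠ ⊤ :=
  have := h.simple l
  (LinearMap.isCoatom_ker_of_surjective hπ).1

/-- A surjection from a nonzero quotient of `P l` onto `L l`. -/
theorem exists_surjective_simple (h : IsProjectiveLabelling L P) {l : W} {M : Type*}
    [AddCommGroup M] [Module A M] [Nontrivial M] (f : P l →ₗ[A] M) (hf : Function.Surjective f) :
    ∃ g : M →ₗ[A] L l, Function.Surjective g := by
  obtain ⟨π, hπ, hN⟩ := h.exists_head l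
  have hk : LinearMap.ker f ≤ LinearMap.ker π := by
    refine hN _ fun ht => ?_
    obtain ⟨y, hy⟩ := exists_ne (0 : M)
    obtain ⟨x, rfl⟩ := hf y
    exact hy (by rw [LinearMap.ker_eq_top.1 ht]; rfl)
  refine ⟨(LinearMap.ker f).liftQ π hk ∘ₗ (f.quotKerEquivOfSurjective hf).symm.toLinearMap, ?_⟩
  rw [LinearMap.coe_comp]
  refine Function.Surjective.comp ?_ (LinearEquiv.surjective _)
  intro y
  obtain ⟨x, rfl⟩ := hπ y
  exact ⟨Submodule.Quotient.mk x, rfl⟩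

theorem eq_of_hom_simple (h : IsProjectiveLabelling L P) {l m : W} (f : P l →ₗ[A] L m)
    (hf : f ≠ 0) : l = m := by
  have := h.simple l
  have := h.simple m
  have hs : Function.Surjective f := LinearMap.surjective_of_ne_zero hf
  have := IsSimpleModule.nontrivial A (L m)
  obtain ⟨g, hg⟩ := h.exists_surjective_simple f hs
  have := IsSimpleModule.nontrivial A (L l)
  have hg0 : g ≠ 0 := by
    rintro rfl
    obtain ⟨y, hy⟩ := exists_ne (0 : L l)
    obtain ⟨x, hx⟩ := hg y
    exact hy (by simpa using hx.symm)
  exact (h.labelling.irredundant m l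
    ⟨LinearEquiv.ofBijective g (LinearMap.bijective_of_ne_zero hg0)⟩).symm

theorem exists_ne_zero_of_surjective (h : IsProjectiveLabelling L P) {l : W} {M : Type*}
    [AddCommGroup M] [Module A M] (g : M →ₗ[A] L l) (hg : Function.Surjective g) :
    ∃ f : P l →ₗ[A] M, g ∘ₗ f ≠ 0 := by
  obtain ⟨π, hπ, -⟩ := h.exists_head l
  obtain ⟨f, hf⟩ := h.exists_lift g hg π
  refine ⟨f, fun h0 => h.ker_head_ne_top hπ ?_⟩
  rw [← hf, h0, LinearMap.ker_zero]

theorem nontrivial_simple (h : IsProjectiveLabelling L P) (l : W) : Nontrivial (L l) :=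
  have := h.simple l
  IsSimpleModule.nontrivial A (L l)

theorem moduleFinite (h : IsProjectiveLabelling L P) (l : W) : Module.Finite A (P l) := by
  obtain ⟨π, hπ, hN⟩ := h.exists_head l
  obtain ⟨y, hy⟩ := @exists_ne _ (h.nontrivial_simple l) 0
  obtain ⟨x, rfl⟩ := hπ y
  have : Submodule.span A {x} = ⊤ := by
    by_contra hne
    exact hy (hN _ hne (Submodule.mem_span_singleton_self x))
  exact ⟨⟨{x}, by simpa using this⟩⟩

/-- A nonzero homomorphism `P l → M` embeds `L l` into a quotient of `M`. -/
theorem exists_simple_injective (h : IsProjectiveLabelling L P) {l : W} {M : Type*}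
    [AddCommGroup M] [Module A M] (f : P l →ₗ[A] M) (hf : f ≠ 0) :
    ∃ (U : Submodule A M) (j : L l →ₗ[A] M ⧸ U), Function.Injective j ∧
      U ≤ LinearMap.range f ∧ LinearMap.range j = (LinearMap.range f).map U.mkQ := by
  obtain ⟨π, hπ, hN⟩ := h.exists_head l
  have hk : LinearMap.ker f ≤ LinearMap.ker π :=
    hN _ fun ht => hf (LinearMap.ker_eq_top.1 ht)
  -- Modulo the image of the radical of `P l`, the image of `f` becomes the head `L l`.
  set U := (LinearMap.ker π).map f with hU
  let e := π.quotKerEquivOfSurjective hπ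
  let g : (P l ⧸ LinearMap.ker π) →ₗ[A] M ⧸ U :=
    Submodule.mapQ _ U f (Submodule.map_le_iff_le_comap.1 le_rfl)
  have hg : Function.Injective g := by
    rw [← LinearMap.ker_eq_bot, Submodule.ker_mapQ, hU, Submodule.comap_map_eq,
      sup_eq_left.2 hk, Submodule.mkQ_map_self]
  refine ⟨U, g ∘ₗ e.symm.toLinearMap, hg.comp e.symm.injective, LinearMap.map_le_range, ?_⟩
  rw [LinearMap.range_comp, LinearEquiv.range, Submodule.map_top, Submodule.range_mapQ]

/-- `L l` is a composition factor of `M` if and only if there is a nonzero map `P l → M`. -/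
theorem isCompFactor_iff (h : IsProjectiveLabelling L P) {l : W} {M : Type*}
    [AddCommGroup M] [Module A M] : IsCompFactor A M (L l) ↔ ∃ f : P l →ₗ[A] M, f ≠ 0 := by
  constructor
  · rintro ⟨-, U, V, -, ⟨e⟩⟩
    obtain ⟨f, hf⟩ := h.exists_ne_zero_of_surjective
      ((e : (V ⧸ U.submoduleOf V) →ₗ[A] L l) ∘ₗ (U.submoduleOf V).mkQ)
      (e.surjective.comp (Submodule.mkQ_surjective _))
    refine ⟨V.subtype ∘ₗ f, fun h0 => hf ?_⟩
    have : f = 0 := by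
      ext x
      exact LinearMap.congr_fun h0 x
    rw [this, LinearMap.comp_zero]
  · rintro ⟨f, hf⟩
    obtain ⟨U, j, hj, hU, hr⟩ := h.exists_simple_injective f hf
    refine ⟨h.simple l, U, LinearMap.range f, hU, ?_⟩
    let g : LinearMap.range f →ₗ[A] M ⧸ U := U.mkQ ∘ₗ (LinearMap.range f).subtype
    have hgk : LinearMap.ker g = U.submoduleOf (LinearMap.range f) := by
      rw [LinearMap.ker_comp, Submodule.ker_mkQ]; rfl
    have hgr : LinearMap.range g = LinearMap.range j := by
      rw [LinearMap.range_comp, Submodule.range_subtype, hr]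
    exact ⟨(Submodule.quotEquivOfEq _ _ hgk.symm).trans
      (g.quotKerEquivRange.trans ((LinearEquiv.ofEq _ _ hgr).trans
        (LinearEquiv.ofInjective j hj).symm))⟩

theorem exists_surjective_of_finite (h : IsProjectiveLabelling L P) {M : Type u} [AddCommGroup M]
    [Module A M] [Module.Finite A M] [Nontrivial M] :
    ∃ (l : W) (g : M →ₗ[A] L l), Function.Surjective g := by
  obtain ⟨N, hN, -⟩ := (eq_top_or_exists_le_coatom (⊥ : Submodule A M)).resolve_left bot_ne_top
  obtain ⟨l, ⟨e⟩⟩ := h.labelling.complete (M ⧸ N) (isSimpleModule_iff_isCoatom.2 hN)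
  exact ⟨l, e.toLinearMap ∘ₗ N.mkQ, e.surjective.comp (Submodule.mkQ_surjective _)⟩

theorem exists_ne_zero (h : IsProjectiveLabelling L P) {M : Type u} [AddCommGroup M]
    [Module A M] [Nontrivial M] : ∃ (l : W) (f : P l →ₗ[A] M), f ≠ 0 := by
  obtain ⟨x, hx⟩ := exists_ne (0 : M)
  have : Nontrivial (Submodule.span A {x}) :=
    (Submodule.nontrivial_iff_ne_bot).2 (by simpa using hx)
  obtain ⟨l, g, hg⟩ := h.exists_surjective_of_finite (M := Submodule.span A {x})
  obtain ⟨f, hf⟩ := h.exists_ne_zero_of_surjective g hg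
  refine ⟨l, (Submodule.span A {x}).subtype ∘ₗ f, fun h0 => hf ?_⟩
  have : f = 0 := by
    ext y
    exact LinearMap.congr_fun h0 y
  rw [this, LinearMap.comp_zero]

end IsProjectiveLabelling

/-! ### Standard modules, standard filtrations and traces. -/

section Sections

variable {A : Type u} [Ring A] {W : Type v} [PartialOrder W]

/-- The section `N' / N` of `M` is isomorphic to the standard module `Δ(m)`. -/
def IsStandardSection (L P : W → ModuleCat.{u} A) {M : Type*} [AddCommGroup M] [Module A M]
    (N N' : Submodule A M) (m : W) : Prop :=
  N ≤ N' ∧ Nonempty ((N' ⧸ N.submoduleOf N') ≃ₗ[A] standard L P m)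

/-- `F` is a filtration of `M` of length `n` whose sections are standard modules `Δ(m)`
with `l ≤ m`. -/
structure IsStandardFiltration (L P : W → ModuleCat.{u} A) {M : Type*} [AddCommGroup M]
    [Module A M] (l : W) (n : ℕ) (F : ℕ → Submodule A M) : Prop where
  zero : F 0 = ⊥
  top : F n = ⊤
  isSection : ∀ i < n, ∃ m, l ≤ m ∧ IsStandardSection L P (F i) (F (i + 1)) m

/-- The sum of the images in `N` of the modules `P r` with `t < r`. -/
def upperTrace (P : W → ModuleCat.{u} A) {M : Type*} [AddCommGroup M] [Module A M] (t : W)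
    (N : Submodule A M) : Submodule A M :=
  sSup {R | ∃ r, t < r ∧ ∃ g : P r →ₗ[A] M, LinearMap.range g ≤ N ∧ LinearMap.range g = R}

variable {L P : W → ModuleCat.{u} A}

theorem range_le_upperTrace {M : Type*} [AddCommGroup M] [Module A M] {t r : W} (htr : t < r)
    {N : Submodule A M} {g : P r →ₗ[A] M} (hg : LinearMap.range g ≤ N) :
    LinearMap.range g ≤ upperTrace P t N :=
  le_sSup ⟨r, htr, g, hg, rfl⟩

theorem upperTrace_le_iff {M : Type*} [AddCommGroup M] [Module A M] {t : W}
    {N K : Submodule A M} : upperTrace P t N ≤ K ↔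
      ∀ r, t < r → ∀ g : P r →ₗ[A] M, LinearMap.range g ≤ N → LinearMap.range g ≤ K := by
  rw [upperTrace, sSup_le_iff]
  constructor
  · intro h r hr g hg
    exact h _ ⟨r, hr, g, hg, rfl⟩
  · rintro h _ ⟨r, hr, g, hg, rfl⟩
    exact h r hr g hg

theorem upperTrace_le_self {M : Type*} [AddCommGroup M] [Module A M] {t : W}
    {N : Submodule A M} : upperTrace P t N ≤ N :=
  upperTrace_le_iff.2 fun _ _ _ hg => hg

namespace IsProjectiveLabelling

theorem range_le_standardKernel (h : IsProjectiveLabelling L P) {l m : W} (hml : ¬ m ≤ l)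
    (g : P m →ₗ[A] P l) : LinearMap.range g ≤ standardKernel L P l := by
  refine le_sInf fun U hU => ?_
  by_contra hle
  refine hml (hU m (h.isCompFactor_iff.2 ⟨U.mkQ ∘ₗ g, fun h0 => hle ?_⟩))
  rwa [← U.ker_mkQ, LinearMap.range_le_ker_iff]

theorem le_of_hom_standard (h : IsProjectiveLabelling L P) {l m : W}
    (f : P m →ₗ[A] standard L P l) (hf : f ≠ 0) : m ≤ l := by
  by_contra hml
  obtain ⟨g, rfl⟩ := h.exists_lift (standardKernel L P l).mkQ (Submodule.mkQ_surjective _) f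
  refine hf (LinearMap.range_le_ker_iff.1 ?_)
  rw [Submodule.ker_mkQ]
  exact h.range_le_standardKernel hml g

theorem standardKernel_ne_top (h : IsProjectiveLabelling L P) (l : W) :
    standardKernel L P l ≠ ⊤ := by
  obtain ⟨π, hπ, -⟩ := h.exists_head l
  refine ne_top_of_le_ne_top (h.ker_head_ne_top hπ) (sInf_le fun m hm => ?_)
  obtain ⟨f, hf⟩ := h.isCompFactor_iff.1 hm
  have e := π.quotKerEquivOfSurjective hπ
  refine (h.eq_of_hom_simple (e.toLinearMap ∘ₗ f) fun h0 => hf ?_).le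
  ext x
  exact e.injective ((LinearMap.congr_fun h0 x).trans (map_zero e).symm)

/-- This is multiplicity one of `L l` in `Δ(l)`: an image inside the radical would make `L l` a
factor of the radical, against `radical_lt`, and any other submodule is everything because `Δ(l)`
has simple head. -/
theorem surjective_of_hom_standard (h : IsProjectiveLabelling L P)
    (hA : IsQuasiHereditary L P) {l : W} (f : P l →ₗ[A] standard L P l) (hf : f ≠ 0) :
    Function.Surjective f := by
  obtain ⟨π, hπ, hN⟩ := h.exists_head l
  have hK := hN _ (h.standardKernel_ne_top l)
  let p : standard L P l →ₗ[A] L l := (standardKernel L P l).liftQ π hK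
  have hp : Function.Surjective p := fun y => by
    obtain ⟨x, rfl⟩ := hπ y
    exact ⟨Submodule.Quotient.mk x, rfl⟩
  by_cases hr : LinearMap.range f ≤ LinearMap.ker p
  · let f' : P l →ₗ[A] LinearMap.ker p := f.codRestrict _ fun x => hr ⟨x, rfl⟩
    have hf' : f' ≠ 0 := fun h0 => hf (by
      ext x
      exact congrArg Subtype.val (LinearMap.congr_fun h0 x))
    exact (lt_irrefl l (hA.radical_lt l p hp l (h.isCompFactor_iff.2 ⟨f', hf'⟩))).elim
  · have ht : (LinearMap.range f).comap (standardKernel L P l).mkQ = ⊤ := by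
      by_contra hne
      refine hr ?_
      rintro y hy
      obtain ⟨x, rfl⟩ := Submodule.mkQ_surjective _ y
      exact hN _ hne hy
    intro y
    obtain ⟨x, rfl⟩ := Submodule.mkQ_surjective _ y
    have hx : x ∈ (LinearMap.range f).comap (standardKernel L P l).mkQ := ht ▸ Submodule.mem_top
    exact hx

/-- A standard section `N' / N ≅ Δ(m)` is presented by a map `q : P m → N'`, through which every
map `P r → N'` factors modulo `N`. -/
theorem exists_presentation (h : IsProjectiveLabelling L P) {M : Type*} [AddCommGroup M]
    [Module A M] {N N' : Submodule A M} {m : W} (hs : IsStandardSection L P N N' m) :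
    ∃ q : P m →ₗ[A] M, N' = N ⊔ LinearMap.range q ∧ N.comap q = standardKernel L P m ∧
      ∀ (r : W) (g : P r →ₗ[A] M), LinearMap.range g ≤ N' →
        ∃ s : P r →ₗ[A] P m, ∀ x, g x - q (s x) ∈ N := by
  obtain ⟨hNN, ⟨e⟩⟩ := hs
  obtain ⟨q, hq⟩ := h.exists_lift (N.submoduleOf N').mkQ (Submodule.mkQ_surjective _)
    ((e.symm : standard L P m →ₗ[A] _) ∘ₗ (standardKernel L P m).mkQ)
  have hsurj : Function.Surjective ((N.submoduleOf N').mkQ ∘ₗ q) := by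
    rw [hq]
    exact e.symm.surjective.comp (Submodule.mkQ_surjective _)
  have hmem : ∀ {y z : N'}, (N.submoduleOf N').mkQ y = (N.submoduleOf N').mkQ z →
      (y : M) - z ∈ N := fun hyz => (Submodule.Quotient.eq (N.submoduleOf N')).1 hyz
  refine ⟨N'.subtype ∘ₗ q, le_antisymm ?_ (sup_le hNN ?_), ?_, ?_⟩
  · intro y hy
    obtain ⟨x, hx⟩ := hsurj ((N.submoduleOf N').mkQ ⟨y, hy⟩)
    have := hmem hx.symm
    rw [← sub_add_cancel y (q x : M)]
    exact Submodule.add_mem_sup this ⟨x, rfl⟩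
  · rintro _ ⟨x, rfl⟩
    exact (q x).2
  · ext x
    have hx := LinearMap.congr_fun hq x
    rw [← Submodule.Quotient.mk_eq_zero (standardKernel L P m)]
    change q x ∈ N.submoduleOf N' ↔ _
    rw [← Submodule.Quotient.mk_eq_zero (N.submoduleOf N')]
    change (N.submoduleOf N').mkQ (q x) = 0 ↔ _
    rw [show (N.submoduleOf N').mkQ (q x) = _ from hx]
    exact e.symm.map_eq_zero_iff
  · intro r g hg
    let g' : P r →ₗ[A] N' := g.codRestrict _ fun x => hg ⟨x, rfl⟩
    obtain ⟨s, hs⟩ := h.exists_lift _ hsurj ((N.submoduleOf N').mkQ ∘ₗ g')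
    exact ⟨s, fun x => hmem (LinearMap.congr_fun hs x).symm⟩

/-- A map `P r → N'` which does not vanish modulo `N` yields a nonzero map to the standard section
`N' / N`. -/
theorem exists_hom_standard_of_section (h : IsProjectiveLabelling L P) {M : Type*}
    [AddCommGroup M] [Module A M] {N N' : Submodule A M} {m : W}
    (hs : IsStandardSection L P N N' m) {r : W} (g : P r →ₗ[A] M)
    (hg : LinearMap.range g ≤ N') (hgN : ¬ LinearMap.range g ≤ N) :
    ∃ f : P r →ₗ[A] standard L P m, f ≠ 0 := by
  obtain ⟨q, -, hqK, hq⟩ := h.exists_presentation hs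
  obtain ⟨s, hsx⟩ := hq r g hg
  refine ⟨(standardKernel L P m).mkQ ∘ₗ s, fun h0 => hgN ?_⟩
  rintro _ ⟨x, rfl⟩
  have hx : s x ∈ standardKernel L P m :=
    (Submodule.Quotient.mk_eq_zero _).1 (LinearMap.congr_fun h0 x)
  rw [← hqK] at hx
  simpa using N.add_mem (hsx x) hx

/-- The kernel of `P l → Δ(l)` is generated by images of the modules `P m` with `l < m`. -/
theorem standardKernel_le (h : IsProjectiveLabelling L P) (hA : IsQuasiHereditary L P) {l : W}
    {N : Submodule A (P l)} (hN : ∀ m, l < m → ∀ g : P m →ₗ[A] P l,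
      LinearMap.range g ≤ standardKernel L P l → LinearMap.range g ≤ N) :
    standardKernel L P l ≤ N := by
  obtain ⟨n, F, hF, h0, hn, hs⟩ := hA.filtration l
  have key : ∀ i ≤ n, F i ≤ N := by
    intro i
    induction i with
    | zero => intro _; rw [h0]; exact bot_le
    | succ i ih =>
      intro hi
      obtain ⟨m, hm, he⟩ := hs i hi
      obtain ⟨q, hq, -, -⟩ := h.exists_presentation (⟨hF i.le_succ, he⟩ :
        IsStandardSection L P (F i) (F (i + 1)) m)
      rw [hq]
      refine sup_le (ih (by omega)) (hN m hm q ?_)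
      rw [← hn]
      exact (le_sup_right.trans hq.ge).trans (hF hi)
  rw [← hn]
  exact key n le_rfl

theorem standardKernel_le_ker (h : IsProjectiveLabelling L P) (hA : IsQuasiHereditary L P)
    {l : W} {M : Type*} [AddCommGroup M] [Module A M] (f : P l →ₗ[A] M)
    (hM : ∀ m, l < m → ∀ g : P m →ₗ[A] M, g = 0) : standardKernel L P l ≤ LinearMap.ker f :=
  h.standardKernel_le hA fun m hm _ _ => LinearMap.range_le_ker_iff.2 (hM m hm _)

theorem exists_filtration (hA : IsQuasiHereditary L P) (l : W) :
    ∃ (n : ℕ) (F : ℕ → Submodule A (P l)), IsStandardFiltration L P l n F := by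
  obtain ⟨n, F, hF, h0, hn, hs⟩ := hA.filtration l
  -- The given filtration stops at the kernel of `P l → Δ(l)`; one more step up to `⊤` adds the
  -- section `Δ(l)`.
  refine ⟨n + 1, fun i => if i ≤ n then F i else ⊤, by simpa using h0, by simp, fun i hi => ?_⟩
  rcases (Nat.lt_succ_iff.1 hi).lt_or_eq with hi | rfl
  · obtain ⟨m, hm, he⟩ := hs i hi
    refine ⟨m, hm.le, ?_⟩
    simp only [if_pos hi.le, if_pos (show i + 1 ≤ n from hi)]
    exact ⟨hF i.le_succ, he⟩
  · refine ⟨l, le_rfl, ?_⟩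
    simp only [le_refl, if_true, if_neg (Nat.not_succ_le_self i), hn]
    refine ⟨le_top, ⟨Submodule.Quotient.equiv _ _ Submodule.topEquiv ?_⟩⟩
    ext x
    simp [Submodule.submoduleOf]

/-- If `t < m`, the trace of `N'` is contained in the trace of `N` plus the image of `q : P m → N'`.
An element `q x` lying in `N` has `x` in the kernel of `P m → Δ(m)`, which is generated by images of
`P r` with `r > m > t`, so `q x` is in the trace of `N`. If not `t < m`, no `L r` with `r > t`
occurs in `Δ(m)`, so passing from `N` to `N'` does not enlarge the trace. -/
theorem inf_upperTrace_le_of_section (h : IsProjectiveLabelling L P) (hA : IsQuasiHereditary L P)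
    {M : Type*} [AddCommGroup M] [Module A M] {N N' : Submodule A M} {m : W}
    (hs : IsStandardSection L P N N' m) (t : W) :
    N ⊓ upperTrace P t N' ≤ upperTrace P t N := by
  by_cases htm : t < m
  · obtain ⟨q, hq, hqK, hqs⟩ := h.exists_presentation hs
    have hle : upperTrace P t N' ≤ upperTrace P t N ⊔ LinearMap.range q := by
      refine upperTrace_le_iff.2 fun r hr g hg => ?_
      obtain ⟨s, hsx⟩ := hqs r g hg
      have hgs : LinearMap.range (g - q ∘ₗ s) ≤ upperTrace P t N := by
        refine range_le_upperTrace hr ?_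
        rintro _ ⟨x, rfl⟩
        exact hsx x
      rintro _ ⟨x, rfl⟩
      rw [← sub_add_cancel (g x) (q (s x))]
      exact Submodule.add_mem_sup (hgs ⟨x, rfl⟩) ⟨s x, rfl⟩
    have hker : standardKernel L P m ≤ (upperTrace P t N).comap q := by
      refine h.standardKernel_le hA fun r hr g hg => ?_
      rw [← Submodule.map_le_iff_le_comap, ← LinearMap.range_comp]
      refine range_le_upperTrace (htm.trans hr) ?_
      rw [LinearMap.range_comp, Submodule.map_le_iff_le_comap, hqK]
      exact hg
    rintro y ⟨hyN, hyT⟩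
    obtain ⟨a, ha, b, ⟨x, rfl⟩, rfl⟩ := Submodule.mem_sup.1 (hle hyT)
    refine add_mem ha (hker ?_)
    rw [← hqK]
    simpa using N.sub_mem hyN (upperTrace_le_self ha)
  · refine inf_le_right.trans (upperTrace_le_iff.2 fun r hr g hg => range_le_upperTrace hr ?_)
    by_contra hgN
    obtain ⟨f, hf⟩ := h.exists_hom_standard_of_section hs g hg hgN
    exact htm (hr.trans_le (h.le_of_hom_standard f hf))

theorem upperTrace_le_of_section (h : IsProjectiveLabelling L P)
    {M : Type*} [AddCommGroup M] [Module A M] {N N' : Submodule A M} {t : W}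
    (hs : IsStandardSection L P N N' t) : upperTrace P t N' ≤ N := by
  refine upperTrace_le_iff.2 fun r hr g hg => ?_
  by_contra hgN
  obtain ⟨f, hf⟩ := h.exists_hom_standard_of_section hs g hg hgN
  exact hr.not_ge (h.le_of_hom_standard f hf)

theorem inf_upperTrace_le_of_filtration (h : IsProjectiveLabelling L P)
    (hA : IsQuasiHereditary L P) {M : Type*} [AddCommGroup M] [Module A M] {l : W} {n : ℕ}
    {F : ℕ → Submodule A M} (hF : IsStandardFiltration L P l n F) (t : W) (i j : ℕ)
    (hij : i + j ≤ n) : F i ≤ F (i + j) ∧ F i ⊓ upperTrace P t (F (i + j)) ≤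
      upperTrace P t (F i) := by
  induction j with
  | zero => exact ⟨le_rfl, inf_le_right⟩
  | succ j ih =>
    obtain ⟨h1, h2⟩ := ih (by omega)
    obtain ⟨m, -, hs⟩ := hF.isSection (i + j) (by omega)
    refine ⟨h1.trans hs.1, ?_⟩
    exact (le_inf inf_le_left ((inf_le_inf_right _ h1).trans
      (h.inf_upperTrace_le_of_section hA hs t))).trans h2

/-- If `Δ(t)` is a section of a standard filtration of `P l`, then `P l` has a quotient with a
submodule `L t` and without composition factors `L r`, `t < r`. -/
theorem exists_quotient_of_section (h : IsProjectiveLabelling L P) (hA : IsQuasiHereditary L P)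
    {l t : W} {n : ℕ} {F : ℕ → Submodule A (P l)} (hF : IsStandardFiltration L P l n F) {i : ℕ}
    (hi : i < n) (hs : IsStandardSection L P (F i) (F (i + 1)) t) :
    ∃ (U : Submodule A (P l)) (j : L t →ₗ[A] P l ⧸ U), Function.Injective j ∧
      ∀ r, t < r → ∀ g : P r →ₗ[A] P l ⧸ U, g = 0 := by
  obtain ⟨q, hq, hqK, -⟩ := h.exists_presentation hs
  set T := upperTrace P t (⊤ : Submodule A (P l)) with hT
  -- Otherwise the image of `q` lies in `F (i + 1) ⊓ T`, hence in the trace of `F (i + 1)`, hence in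
  -- `F i`, and `Δ(t)` would vanish.
  have hqT : T.mkQ ∘ₗ q ≠ 0 := by
    intro h0
    rw [← LinearMap.range_le_ker_iff, Submodule.ker_mkQ] at h0
    have h1 := (h.inf_upperTrace_le_of_filtration hA hF t (i + 1) (n - (i + 1)) (by omega)).2
    rw [show i + 1 + (n - (i + 1)) = n by omega, hF.top] at h1
    have h2 : LinearMap.range q ≤ F i :=
      (le_inf (le_sup_right.trans hq.ge) h0).trans (h1.trans (h.upperTrace_le_of_section hs))
    refine h.standardKernel_ne_top t ?_
    rw [← hqK, eq_top_iff]
    exact fun x _ => h2 ⟨x, rfl⟩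
  obtain ⟨U, j, hj, -, -⟩ := h.exists_simple_injective _ hqT
  have hTU : T ≤ U.comap T.mkQ := by
    conv_lhs => rw [← T.ker_mkQ]
    exact LinearMap.ker_le_comap _
  let e : ((P l ⧸ T) ⧸ U) →ₗ[A] P l ⧸ U.comap T.mkQ :=
    U.liftQ (T.liftQ (U.comap T.mkQ).mkQ (by rwa [Submodule.ker_mkQ])) (by
      intro y hy
      obtain ⟨x, rfl⟩ := T.mkQ_surjective y
      exact (Submodule.Quotient.mk_eq_zero _).2 hy)
  have he : Function.Injective e := by
    rw [← LinearMap.ker_eq_bot, eq_bot_iff]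
    intro y hy
    obtain ⟨y, rfl⟩ := U.mkQ_surjective y
    obtain ⟨x, rfl⟩ := T.mkQ_surjective y
    exact (Submodule.Quotient.mk_eq_zero U).2
      ((Submodule.Quotient.mk_eq_zero (U.comap T.mkQ)).1 hy)
  refine ⟨U.comap T.mkQ, e ∘ₗ j, he.comp hj, fun r hr g => ?_⟩
  obtain ⟨g', rfl⟩ := h.exists_lift _ (U.comap T.mkQ).mkQ_surjective g
  rw [← LinearMap.range_le_ker_iff, Submodule.ker_mkQ]
  exact (range_le_upperTrace hr le_top).trans hTU

/-- A nonzero map on `P l` is nonzero on some standard section of a filtration of `P l`. -/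
theorem exists_section_of_ne_zero (h : IsProjectiveLabelling L P) {l : W} {n : ℕ}
    {F : ℕ → Submodule A (P l)} (hF : IsStandardFiltration L P l n F) {M : Type*}
    [AddCommGroup M] [Module A M] (f : P l →ₗ[A] M) (hf : f ≠ 0) :
    ∃ i < n, ∃ (t : W) (q : P t →ₗ[A] P l), l ≤ t ∧
      IsStandardSection L P (F i) (F (i + 1)) t ∧ f ∘ₗ q ≠ 0 ∧
      standardKernel L P t ≤ LinearMap.ker (f ∘ₗ q) := by
  by_contra! hcon
  have key : ∀ i ≤ n, F i ≤ LinearMap.ker f := by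
    intro i
    induction i with
    | zero => intro _; rw [hF.zero]; exact bot_le
    | succ i ih =>
      intro hi
      obtain ⟨t, ht, hs⟩ := hF.isSection i hi
      obtain ⟨q, hq, hqK, -⟩ := h.exists_presentation hs
      rw [hq]
      refine sup_le (ih (by omega)) ?_
      rw [LinearMap.range_le_ker_iff]
      by_contra hne
      refine hcon i hi t q ht hs hne ?_
      rw [← hqK, LinearMap.ker_comp]
      exact Submodule.comap_mono (ih (by omega))
  refine hf (LinearMap.ker_eq_top.1 (top_le_iff.1 ?_))
  rw [← hF.top]
  exact key n le_rfl

/-- A composition factor of a module with a standard filtration is a composition factor of one of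
the sections. -/
theorem exists_section_of_hom (h : IsProjectiveLabelling L P) {l : W} {n : ℕ}
    {F : ℕ → Submodule A (P l)} (hF : IsStandardFiltration L P l n F) {r : W}
    (f : P r →ₗ[A] P l) (hf : f ≠ 0) :
    ∃ i < n, ∃ t : W, IsStandardSection L P (F i) (F (i + 1)) t ∧
      ∃ g : P r →ₗ[A] standard L P t, g ≠ 0 := by
  by_contra! hcon
  -- Descending from the top: if `f` vanished on every section, its image would sink to `F 0 = ⊥`.
  have key : ∀ i ≤ n, LinearMap.range f ≤ F (n - i) := by
    intro i
    induction i with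
    | zero => intro _; rw [Nat.sub_zero, hF.top]; exact le_top
    | succ i ih =>
      intro hi
      obtain ⟨t, -, hs⟩ := hF.isSection (n - (i + 1)) (by omega)
      by_contra hne
      have h1 := ih (by omega)
      rw [show n - i = n - (i + 1) + 1 by omega] at h1
      obtain ⟨g, hg⟩ := h.exists_hom_standard_of_section hs f h1 hne
      exact hg (hcon _ (by omega) t hs g)
  refine hf (LinearMap.range_eq_bot.1 (le_bot_iff.1 ?_))
  rw [← hF.zero, ← Nat.sub_self n]
  exact key n le_rfl

end IsProjectiveLabelling

end Sections

/-! ### Dualities on finitely generated modules. -/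

section FG

variable {A : Type u} [Ring A]

/-- Elements of `X` are maps from the free module of rank one, which is finitely generated; this
avoids kernels, which need not be finitely generated over a general ring. -/
theorem mono_iff_injective_fg {X Y : FGModuleCat.{u} A} (f : X ⟶ Y) :
    Mono f ↔ Function.Injective f.hom.hom := by
  constructor
  · intro hf
    rw [injective_iff_map_eq_zero]
    intro x hx
    let a : FGModuleCat.of A A ⟶ X := FGModuleCat.ofHom (LinearMap.toSpanSingleton A X x)
    let b : FGModuleCat.of A A ⟶ X := FGModuleCat.ofHom (0 : A →ₗ[A] X)
    have hab : a = b := by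
      rw [← cancel_mono f]
      apply FGModuleCat.hom_ext
      ext
      change f.hom.hom ((1 : A) • x) = f.hom.hom 0
      rw [one_smul, hx, map_zero]
    have h1 : a.hom.hom (1 : A) = b.hom.hom (1 : A) := by rw [hab]
    change (1 : A) • x = 0 at h1
    rwa [one_smul] at h1
  · intro hf
    refine ⟨fun a b hab => ?_⟩
    apply FGModuleCat.hom_ext
    refine LinearMap.ext fun x => hf ?_
    exact congrArg (fun c => c.hom.hom x) hab

theorem epi_iff_surjective_fg {X Y : FGModuleCat.{u} A} (f : X ⟶ Y) :
    Epi f ↔ Function.Surjective f.hom.hom := by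
  constructor
  · intro hf
    let C := Y ⧸ LinearMap.range f.hom.hom
    let a : Y ⟶ FGModuleCat.of A C := FGModuleCat.ofHom (LinearMap.range f.hom.hom).mkQ
    let b : Y ⟶ FGModuleCat.of A C := FGModuleCat.ofHom (0 : Y →ₗ[A] C)
    have hab : a = b := by
      rw [← cancel_epi f]
      apply FGModuleCat.hom_ext
      refine LinearMap.ext fun x => ?_
      exact (Submodule.Quotient.mk_eq_zero _).2 ⟨x, rfl⟩
    intro y
    have h1 : a.hom.hom y = b.hom.hom y := by rw [hab]
    exact (Submodule.Quotient.mk_eq_zero _).1 h1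
  · intro hf
    refine ⟨fun a b hab => ?_⟩
    apply FGModuleCat.hom_ext
    refine LinearMap.ext fun y => ?_
    obtain ⟨x, rfl⟩ := hf y
    exact congrArg (fun c => c.hom.hom x) hab

/-- The dual of a finitely generated module. -/
abbrev Duality.obj (D : Duality A) (X : FGModuleCat.{u} A) : FGModuleCat.{u} A :=
  D.functor.obj (Opposite.op X)

/-- The dual of a homomorphism. -/
def Duality.map (D : Duality A) {X Y : FGModuleCat.{u} A} (f : X →ₗ[A] Y) :
    D.obj Y →ₗ[A] D.obj X :=
  (D.functor.map (Quiver.Hom.op (FGModuleCat.ofHom f : X ⟶ Y))).hom.hom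

theorem Duality.map_surjective_iff (D : Duality A) {X Y : FGModuleCat.{u} A} (f : X →ₗ[A] Y) :
    Function.Surjective (D.map f) ↔ Function.Injective f := by
  rw [Duality.map, ← epi_iff_surjective_fg, D.functor.epi_map_iff_epi, op_epi_iff,
    mono_iff_injective_fg]
  rfl

theorem Duality.map_injective_iff (D : Duality A) {X Y : FGModuleCat.{u} A} (f : X →ₗ[A] Y) :
    Function.Injective (D.map f) ↔ Function.Surjective f := by
  rw [Duality.map, ← mono_iff_injective_fg, D.functor.mono_map_iff_mono, op_mono_iff,
    epi_iff_surjective_fg]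
  rfl

theorem Duality.exists_map_eq (D : Duality A) {X Y : FGModuleCat.{u} A}
    (g : D.obj Y →ₗ[A] D.obj X) : ∃ f : X →ₗ[A] Y, D.map f = g := by
  obtain ⟨f, hf⟩ := D.functor.map_surjective (FGModuleCat.ofHom g : D.obj Y ⟶ D.obj X)
  exact ⟨f.unop.hom.hom, congrArg (fun c => c.hom.hom) hf⟩

theorem Duality.exists_obj_equiv (D : Duality A) (V : Type u) [AddCommGroup V] [Module A V]
    [Module.Finite A V] : ∃ Z : FGModuleCat.{u} A, Nonempty (D.obj Z ≃ₗ[A] V) :=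
  ⟨(D.functor.objPreimage (FGModuleCat.of A V)).unop,
    ⟨FGModuleCat.isoToLinearEquiv (D.functor.objObjPreimageIso (FGModuleCat.of A V))⟩⟩

theorem Duality.nontrivial_of_obj (D : Duality A) (Z : FGModuleCat.{u} A)
    [Nontrivial (D.obj Z)] : Nontrivial Z := by
  by_contra hZ
  rw [not_nontrivial_iff_subsingleton] at hZ
  obtain ⟨f, hf⟩ := D.exists_map_eq (LinearMap.id : D.obj Z →ₗ[A] D.obj Z)
  obtain ⟨g, hg⟩ := D.exists_map_eq (0 : D.obj Z →ₗ[A] D.obj Z)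
  have hfg : f = g := LinearMap.ext fun x => Subsingleton.elim _ _
  obtain ⟨y, hy⟩ := exists_ne (0 : D.obj Z)
  refine hy ?_
  have h1 : D.map f y = D.map g y := by rw [hfg]
  rwa [hf, hg] at h1

end FG

/-! ### Reciprocity from a simple-preserving duality. -/

namespace IsProjectiveLabelling

variable {A : Type u} [Ring A] {W : Type v} {L P : W → ModuleCat.{u} A}

theorem moduleFinite_simple (h : IsProjectiveLabelling L P) (l : W) : Module.Finite A (L l) := by
  obtain ⟨π, hπ, -⟩ := h.exists_head l
  have := h.moduleFinite l
  exact Module.Finite.of_surjective π hπ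

theorem exists_dual_simple_equiv (h : IsProjectiveLabelling L P) {D : Duality A}
    (hD : D.SimplePreserving) (l : W) [Module.Finite A (L l)] :
    Nonempty (D.obj (FGModuleCat.of A (L l)) ≃ₗ[A] L l) :=
  hD (FGModuleCat.of A (L l)) (h.simple l)

/-- A composition factor of the dual of `X` is a composition factor of `X`. -/
theorem exists_hom_of_hom_dual (h : IsProjectiveLabelling L P) {D : Duality A}
    (hD : D.SimplePreserving) {X : FGModuleCat.{u} A} {l : W} (g : P l →ₗ[A] D.obj X)
    (hg : g ≠ 0) : ∃ f : P l →ₗ[A] X, f ≠ 0 := by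
  have := h.moduleFinite_simple l
  obtain ⟨U, j, hj, -, -⟩ := h.exists_simple_injective g hg
  -- Undoing the duality, the quotient map becomes an embedding `a : Z → X` and `L l ↪ D X / U`
  -- becomes a surjection `b : Z → L l`.
  obtain ⟨Z, ⟨e⟩⟩ := D.exists_obj_equiv (D.obj X ⧸ U)
  obtain ⟨d⟩ := h.exists_dual_simple_equiv hD l
  obtain ⟨a, ha⟩ := D.exists_map_eq ((e.symm : _ →ₗ[A] D.obj Z) ∘ₗ U.mkQ)
  obtain ⟨b, hb⟩ := D.exists_map_eq ((e.symm : _ →ₗ[A] D.obj Z) ∘ₗ j ∘ₗ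
    (d : D.obj (FGModuleCat.of A (L l)) →ₗ[A] L l))
  have hainj : Function.Injective a := by
    rw [← D.map_surjective_iff, ha]
    exact e.symm.surjective.comp U.mkQ_surjective
  have hbsurj : Function.Surjective b := by
    rw [← D.map_injective_iff, hb]
    exact e.symm.injective.comp (hj.comp d.injective)
  obtain ⟨f, hf⟩ := h.exists_ne_zero_of_surjective b hbsurj
  refine ⟨a ∘ₗ f, fun h0 => hf ?_⟩
  have : f = 0 := LinearMap.ext fun x =>
    hainj ((LinearMap.congr_fun h0 x).trans (map_zero a).symm)
  rw [this, LinearMap.comp_zero]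

variable [PartialOrder W]

/-- Qualitative reciprocity: if `Δ(t)` is a section of a standard filtration of `P l`, then `L l`
is a composition factor of `Δ(t)`. -/
theorem exists_hom_standard_of_mem_filtration [IsNoetherianRing A]
    (h : IsProjectiveLabelling L P) (hA : IsQuasiHereditary L P) {D : Duality A}
    (hD : D.SimplePreserving) {l t : W} {n : ℕ} {F : ℕ → Submodule A (P l)}
    (hF : IsStandardFiltration L P l n F) {i : ℕ} (hi : i < n)
    (hs : IsStandardSection L P (F i) (F (i + 1)) t) :
    ∃ f : P l →ₗ[A] standard L P t, f ≠ 0 := by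
  have := h.moduleFinite l
  have := h.moduleFinite_simple l
  have := h.moduleFinite_simple t
  obtain ⟨U, j, hj, hU⟩ := h.exists_quotient_of_section hA hF hi hs
  let Q := FGModuleCat.of A (P l ⧸ U)
  obtain ⟨d⟩ := h.exists_dual_simple_equiv hD t
  -- The submodule `L t` of `Q` dualises to a quotient `L t` of `D Q`, and so gives a map `P t → D
  -- Q`.
  obtain ⟨f, hf⟩ := h.exists_ne_zero_of_surjective
    ((d : D.obj (FGModuleCat.of A (L t)) →ₗ[A] L t) ∘ₗ
      D.map (X := FGModuleCat.of A (L t)) (Y := Q) j)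
    (d.surjective.comp ((D.map_surjective_iff _).2 hj))
  have hf0 : f ≠ 0 := by
    rintro rfl
    exact hf (LinearMap.comp_zero _)
  -- `D Q` has only composition factors of `Q`, hence no `L r` with `t < r`; thus the image of `f`
  -- is a quotient of `Δ(t)`.
  have hK : standardKernel L P t ≤ LinearMap.ker f := by
    refine h.standardKernel_le_ker hA f fun r hr g => ?_
    by_contra hg
    obtain ⟨f', hf'⟩ := h.exists_hom_of_hom_dual hD g hg
    exact hf' (hU r hr f')
  have hfin : Module.Finite A (LinearMap.range f) :=
    have := h.moduleFinite t
    inferInstance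
  obtain ⟨Z, ⟨e⟩⟩ := D.exists_obj_equiv (LinearMap.range f)
  have : Nontrivial (LinearMap.range f) :=
    Submodule.nontrivial_iff_ne_bot.2 fun h0 => hf0 (LinearMap.range_eq_bot.1 h0)
  have : Nontrivial (D.obj Z) := e.toEquiv.nontrivial
  have := D.nontrivial_of_obj Z
  -- As a submodule of `D Q`, the image of `f` is dual to a nonzero quotient `Z` of `Q`, and so of
  -- `P l`. Since `Z` maps onto `L l`, its dual contains `L l`.
  obtain ⟨a, ha⟩ := D.exists_map_eq (X := Q) (Y := Z) ((LinearMap.range f).subtype ∘ₗ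
    (e : D.obj Z →ₗ[A] LinearMap.range f))
  have hasurj : Function.Surjective a := by
    rw [← D.map_injective_iff, ha]
    exact Subtype.val_injective.comp e.injective
  obtain ⟨g, hg⟩ := h.exists_surjective_simple (a ∘ₗ U.mkQ) (hasurj.comp U.mkQ_surjective)
  obtain ⟨d'⟩ := h.exists_dual_simple_equiv hD l
  let c : L l →ₗ[A] LinearMap.range f := (e : D.obj Z →ₗ[A] LinearMap.range f) ∘ₗ
    D.map (X := Z) (Y := FGModuleCat.of A (L l)) g ∘ₗ
      (d'.symm : L l →ₗ[A] D.obj (FGModuleCat.of A (L l)))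
  have hc : Function.Injective c :=
    e.injective.comp (((D.map_injective_iff _).2 hg).comp d'.symm.injective)
  obtain ⟨π, hπ, -⟩ := h.exists_head l
  obtain ⟨q, hq⟩ := h.exists_lift ((standardKernel L P t).liftQ f.rangeRestrict
    (by rwa [LinearMap.ker_rangeRestrict])) (fun y => by
      obtain ⟨_, x, rfl⟩ := y
      exact ⟨Submodule.Quotient.mk x, rfl⟩) (c ∘ₗ π)
  refine ⟨q, fun h0 => h.ker_head_ne_top hπ ?_⟩
  rw [h0, LinearMap.comp_zero] at hq
  refine LinearMap.ker_eq_top.2 (LinearMap.ext fun x => hc ?_)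
  rw [LinearMap.zero_apply, map_zero]
  exact (LinearMap.congr_fun hq x).symm

end IsProjectiveLabelling

/-! ### Components of the `Hom` quiver and linkage of projectives. -/

section HomQuiver

variable {k : Type w} [Field k] {A : Type u} [Ring A] [Algebra k A] {W : Type v} [PartialOrder W]
  {L P : W → ModuleCat.{u} A}

open scoped ModuleCat in
theorem finite_hom [Module.Finite k A] (M N : ModuleCat.{u} A) [Module.Finite A M]
    [Module.Finite A N] : Module.Finite k (M ⟶ N) := by
  have hN : Module.Finite k N := Module.Finite.trans A N
  have hM : Module.Finite k M := Module.Finite.trans A M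
  let ev : (M ⟶ N) →ₗ[k] (M →ₗ[k] N) :=
    { toFun := fun f => f.hom.restrictScalars k
      map_add' := fun _ _ => rfl
      map_smul' := fun _ _ => rfl }
  refine Module.Finite.of_injective ev fun f g hfg => ?_
  ext x
  exact LinearMap.congr_fun hfg x

namespace IsProjectiveLabelling

theorem homComponent_eq_of_hom [Module.Finite k A] (h : IsProjectiveLabelling L P) {l m : W}
    (f : standard L P l →ₗ[A] standard L P m) (hf : f ≠ 0) :
    homComponent k L P l = homComponent k L P m := by
  have := h.moduleFinite l
  have := h.moduleFinite m
  -- `finrank` is zero on infinite-dimensional spaces, so finiteness is needed for a nonzero map to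
  -- give an arrow.
  have hfin : Module.Finite k (standard L P l ⟶ standard L P m) := finite_hom _ _
  have hnt : Nontrivial (standard L P l ⟶ standard L P m) :=
    ⟨ModuleCat.ofHom f, 0, fun h0 => hf (congrArg ModuleCat.Hom.hom h0)⟩
  let a : Quiver.Hom (V := HomQuiver k L P) l m :=
    (⟨0, Module.finrank_pos⟩ : Fin (Module.finrank k (standard L P l ⟶ standard L P m)))
  exact (Quiver.WeaklyConnectedComponent.eq (V := HomQuiver k L P) l m).2
    ⟨Quiver.Hom.toPath (V := Quiver.Symmetrify (HomQuiver k L P)) (Sum.inl a)⟩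

/-- A function on `W` which is constant along nonzero maps between standard modules is constant
on the components of the `Hom` quiver. -/
theorem apply_eq_of_homComponent_eq {β : Type*} (b : W → β)
    (hb : ∀ (l m : W) (f : standard L P l →ₗ[A] standard L P m), f ≠ 0 → b l = b m) {l m : W}
    (hlm : homComponent k L P l = homComponent k L P m) : b l = b m := by
  have harrow : ∀ l m : HomQuiver k L P, (l ⟶ m) → b l = b m := by
    intro l m a
    have hpos : 0 < Module.finrank k (standard L P l ⟶ standard L P m) :=
      lt_of_le_of_lt (Nat.zero_le _) (show Fin _ from a).2
    have hnt : Nontrivial (standard L P l ⟶ standard L P m) := by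
      by_contra hs
      rw [not_nontrivial_iff_subsingleton] at hs
      exact hpos.ne' (Module.finrank_zero_of_subsingleton)
    obtain ⟨f, hf⟩ := exists_ne (0 : standard L P l ⟶ standard L P m)
    exact hb l m f.hom fun h0 => hf (ModuleCat.hom_ext h0)
  obtain ⟨p⟩ := (Quiver.WeaklyConnectedComponent.eq (V := HomQuiver k L P) l m).1 hlm
  induction p with
  | nil => rfl
  | cons _ a ih =>
    refine (ih ?_).trans ?_
    · exact (Quiver.WeaklyConnectedComponent.eq (V := HomQuiver k L P) _ _).2 ⟨by assumption⟩
    · rcases a with a | a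
      · exact harrow _ _ a
      · exact (harrow _ _ a).symm

variable [Module.Finite k A]

/-- The map `g` is nonzero on some section `Δ(s)` of `P l`, which gives a nonzero map `Δ(s) → Δ(t)`
and `s ≤ t`. If `s < t`, reciprocity puts `L l` in `Δ(s)` and induction applies. If `s = t`,
multiplicity one makes `g` surjective, and comparing heads gives `l = t`. -/
theorem homComponent_eq_of_hom_standard [Finite W] (h : IsProjectiveLabelling L P)
    (hA : IsQuasiHereditary L P) {D : Duality A} (hD : D.SimplePreserving) (t : W) :
    ∀ {l : W} (g : P l →ₗ[A] standard L P t), g ≠ 0 →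
      homComponent k L P l = homComponent k L P t := by
  have : IsNoetherianRing A := isNoetherian_of_tower k inferInstance
  have hwf : WellFoundedLT W := inferInstance
  induction t using hwf.induction with
  | ind t ih =>
    intro l g hg
    obtain ⟨n, F, hF⟩ := exists_filtration hA l
    obtain ⟨i, hi, s, q, hls, hs, hq, hqK⟩ := h.exists_section_of_ne_zero hF g hg
    have hst : s ≤ t := h.le_of_hom_standard _ hq
    rcases hst.lt_or_eq with hlt | rfl
    · obtain ⟨f, hf⟩ := h.exists_hom_standard_of_mem_filtration hA hD hF hi hs
      refine (ih s hlt f hf).trans (h.homComponent_eq_of_hom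
        ((standardKernel L P s).liftQ (g ∘ₗ q) hqK) fun h0 => hq ?_)
      ext x
      exact LinearMap.congr_fun h0 (Submodule.Quotient.mk x)
    · have hsurj := h.surjective_of_hom_standard hA _ hq
      rw [LinearMap.coe_comp] at hsurj
      have hnt : Nontrivial (standard L P s) :=
        Submodule.Quotient.nontrivial_iff.2 (h.standardKernel_ne_top s)
      obtain ⟨p, hp⟩ := h.exists_surjective_simple (standardKernel L P s).mkQ
        (Submodule.mkQ_surjective _)
      have hne : p ∘ₗ g ≠ 0 := by
        have := h.nontrivial_simple s
        obtain ⟨y, hy⟩ := exists_ne (0 : L s)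
        obtain ⟨x, rfl⟩ := (hp.comp hsurj.of_comp) y
        exact fun h0 => hy (LinearMap.congr_fun h0 x)
      rw [h.eq_of_hom_simple _ hne]

theorem homComponent_eq_of_hom_projective [Finite W] (h : IsProjectiveLabelling L P)
    (hA : IsQuasiHereditary L P) {D : Duality A} (hD : D.SimplePreserving) {l m : W}
    (f : P l →ₗ[A] P m) (hf : f ≠ 0) : homComponent k L P l = homComponent k L P m := by
  have : IsNoetherianRing A := isNoetherian_of_tower k inferInstance
  obtain ⟨n, F, hF⟩ := exists_filtration hA m
  obtain ⟨i, hi, t, hs, g, hg⟩ := h.exists_section_of_hom hF f hf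
  obtain ⟨g', hg'⟩ := h.exists_hom_standard_of_mem_filtration hA hD hF hi hs
  exact (h.homComponent_eq_of_hom_standard hA hD t g hg).trans
    (h.homComponent_eq_of_hom_standard hA hD t g' hg').symm

end IsProjectiveLabelling

end HomQuiver

/-! ### Blocks, supports and central idempotents. -/

section Blocks

variable {A : Type u} [Ring A]

/-- Multiplication by a central element, as an endomorphism. -/
def centralSMul (M : Type*) [AddCommGroup M] [Module A M] {c : A} (hc : c ∈ Subring.center A) :
    M →ₗ[A] M where
  toFun x := c • x
  map_add' := smul_add c
  map_smul' a x := by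
    rw [RingHom.id_apply, smul_smul, smul_smul, Subring.mem_center_iff.1 hc a]

theorem Block.Contains.of_surjective {b : Block A} {M N : Type*} [AddCommGroup M] [Module A M]
    [AddCommGroup N] [Module A N] (hM : b.Contains M) (f : M →ₗ[A] N)
    (hf : Function.Surjective f) : b.Contains N := by
  intro y
  obtain ⟨x, rfl⟩ := hf y
  rw [← map_smul, hM x]

/-- Modules linked by a nonzero homomorphism belong to the same block. -/
theorem Block.eq_of_hom {b b' : Block A} {M N : Type*} [AddCommGroup M] [Module A M]
    [AddCommGroup N] [Module A N] (hM : b.Contains M) (hN : b'.Contains N) (f : M →ₗ[A] N)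
    (hf : f ≠ 0) : b = b' := by
  have hM : ∀ x : M, b.1 • x = x := hM
  have hN : ∀ x : N, b'.1 • x = x := hN
  set e := b.1 with he
  set e' := b'.1 with he'
  obtain ⟨hec, hei, -, hep⟩ := b.2
  obtain ⟨hec', hei', -, hep'⟩ := b'.2
  rw [← he] at hec hei hep
  rw [← he'] at hec' hei' hep'
  have hcomm : e * e' = e' * e := Subring.mem_center_iff.1 hec' e
  have hid : IsIdempotentElem (e * e') := hei.mul_of_commute hcomm hei'
  have hne : e * e' ≠ 0 := by
    intro h0
    refine hf (LinearMap.ext fun x => ?_)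
    have h1 : e • x = x := hM x
    have h2 : e' • f x = f x := hN (f x)
    rw [← h2, ← h1, map_smul, smul_smul, ← hcomm, h0, zero_smul, LinearMap.zero_apply]
  have h1 := (hep _ (Subring.mul_mem _ hec hec') hid (by
    rw [mul_assoc, ← hcomm, ← mul_assoc, hei.eq])).resolve_left hne
  have h2 := (hep' _ (Subring.mul_mem _ hec hec') hid (by rw [mul_assoc, hei'.eq])).resolve_left hne
  exact Subtype.ext (h1.symm.trans h2)

/-- All composition factors of `M` have labels in `C`. -/
def IsSupportedIn {W : Type v} (P : W → ModuleCat.{u} A) (C : Set W) (M : Type*) [AddCommGroup M]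
    [Module A M] : Prop :=
  ∀ r ∉ C, ∀ f : P r →ₗ[A] M, f = 0

namespace IsProjectiveLabelling

variable {W : Type v} {L P : W → ModuleCat.{u} A}

theorem isSupportedIn_of_surjective (h : IsProjectiveLabelling L P) {C : Set W} {M N : Type*}
    [AddCommGroup M] [Module A M] [AddCommGroup N] [Module A N] (hM : IsSupportedIn P C M)
    (g : M →ₗ[A] N) (hg : Function.Surjective g) : IsSupportedIn P C N := by
  intro r hr f
  obtain ⟨f', rfl⟩ := h.exists_lift g hg f
  rw [hM r hr f', LinearMap.comp_zero]

theorem isSupportedIn_range (h : IsProjectiveLabelling L P) {C : Set W} {M N : Type*}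
    [AddCommGroup M] [Module A M] [AddCommGroup N] [Module A N] (hM : IsSupportedIn P C M)
    (g : M →ₗ[A] N) : IsSupportedIn P C (LinearMap.range g) :=
  h.isSupportedIn_of_surjective hM g.rangeRestrict g.surjective_rangeRestrict

theorem isSupportedIn_sup (h : IsProjectiveLabelling L P) {C : Set W} {M : Type*}
    [AddCommGroup M] [Module A M] {N N' : Submodule A M} (hN : IsSupportedIn P C N)
    (hN' : IsSupportedIn P C N') : IsSupportedIn P C (N ⊔ N' : Submodule A M) := by
  have hprod : IsSupportedIn P C (N × N') := fun r hr f => by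
    refine LinearMap.ext fun x => Prod.ext ?_ ?_
    · exact LinearMap.congr_fun (hN r hr (LinearMap.fst A N N' ∘ₗ f)) x
    · exact LinearMap.congr_fun (hN' r hr (LinearMap.snd A N N' ∘ₗ f)) x
  have := h.isSupportedIn_range hprod (N.subtype.coprod N'.subtype)
  rwa [LinearMap.range_coprod, Submodule.range_subtype, Submodule.range_subtype] at this

theorem _root_.QuasiHered.IsSupportedIn.of_injective {C : Set W} {M N : Type*}
    [AddCommGroup M] [Module A M] [AddCommGroup N] [Module A N] (hN : IsSupportedIn P C N)
    (g : M →ₗ[A] N) (hg : Function.Injective g) : IsSupportedIn P C M := fun r hr f =>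
  LinearMap.ext fun x => hg <| by
    rw [LinearMap.zero_apply, map_zero]
    exact LinearMap.congr_fun (hN r hr (g ∘ₗ f)) x

theorem subsingleton_of_isSupportedIn (h : IsProjectiveLabelling L P) {C : Set W} {M : Type u}
    [AddCommGroup M] [Module A M] (hM : IsSupportedIn P C M) (hM' : IsSupportedIn P Cᶜ M) :
    Subsingleton M := by
  by_contra hs
  rw [not_subsingleton_iff_nontrivial] at hs
  obtain ⟨l, f, hf⟩ := h.exists_ne_zero (M := M)
  by_cases hl : l ∈ C
  · exact hf (hM' l (fun hl' => hl' hl) f)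
  · exact hf (hM l hl f)

theorem hom_eq_zero_of_isSupportedIn (h : IsProjectiveLabelling L P) {C : Set W} {M N : Type u}
    [AddCommGroup M] [Module A M] [AddCommGroup N] [Module A N] (hM : IsSupportedIn P C M)
    (hN : IsSupportedIn P Cᶜ N) (f : M →ₗ[A] N) : f = 0 := by
  have := h.subsingleton_of_isSupportedIn (h.isSupportedIn_range hM f)
    (hN.of_injective (LinearMap.range f).subtype Subtype.val_injective)
  rwa [← LinearMap.range_eq_bot, ← Submodule.subsingleton_iff_eq_bot]

theorem exists_greatest_isSupportedIn [IsNoetherianRing A] (h : IsProjectiveLabelling L P)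
    (C : Set W) : ∃ I : Ideal A, IsSupportedIn P C I ∧
      ∀ N : Ideal A, IsSupportedIn P C N → N ≤ I := by
  obtain ⟨I, hI, hmax⟩ := (wellFounded_gt (α := Ideal A)).has_min
    {N : Ideal A | IsSupportedIn P C N}
    ⟨⊥, fun r _ f => LinearMap.ext fun x => Subsingleton.elim _ _⟩
  refine ⟨I, hI, fun N hN => ?_⟩
  by_contra hle
  exact hmax _ (h.isSupportedIn_sup hI hN) (left_lt_sup.2 hle)

/-- If `C` is closed under linkage of projectives, there is a central idempotent acting as the
identity on `P r` for `r ∈ C` and as zero on `P r` for `r ∉ C`. -/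
theorem exists_central_idempotent [IsNoetherianRing A] (h : IsProjectiveLabelling L P)
    {C : Set W} (hC : ∀ (r s : W) (f : P r →ₗ[A] P s), f ≠ 0 → (r ∈ C ↔ s ∈ C)) :
    ∃ c ∈ Subring.center A, IsIdempotentElem c ∧ (∀ r ∈ C, ∀ x : P r, c • x = x) ∧
      ∀ r ∉ C, ∀ x : P r, c • x = 0 := by
  have hP : ∀ r ∈ C, IsSupportedIn P C (P r) := fun r hr s hs f => by
    by_contra hf
    exact hs ((hC s r f hf).2 hr)
  have hP' : ∀ r ∉ C, IsSupportedIn P Cᶜ (P r) := fun r hr s hs f => by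
    by_contra hf
    exact hr ((hC s r f hf).1 (not_not.1 hs))
  obtain ⟨I, hI, hImax⟩ := h.exists_greatest_isSupportedIn C
  obtain ⟨J, hJ, hJmax⟩ := h.exists_greatest_isSupportedIn Cᶜ
  -- Right multiplication is left linear, so it preserves supports; maximality makes `I` and `J`
  -- two-sided.
  have hIr : ∀ x ∈ I, ∀ a, x * a ∈ I := fun x hx a =>
    hImax _ (h.isSupportedIn_range hI (LinearMap.toSpanSingleton A A a ∘ₗ I.subtype))
      ⟨⟨x, hx⟩, rfl⟩
  have hJr : ∀ x ∈ J, ∀ a, x * a ∈ J := fun x hx a =>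
    hJmax _ (h.isSupportedIn_range hJ (LinearMap.toSpanSingleton A A a ∘ₗ J.subtype))
      ⟨⟨x, hx⟩, rfl⟩
  have hIJ : ∀ x ∈ I, x ∈ J → x = 0 := by
    intro x hxI hxJ
    have : Subsingleton (I ⊓ J : Ideal A) := h.subsingleton_of_isSupportedIn
      (hI.of_injective (Submodule.inclusion inf_le_left) (Submodule.inclusion_injective _))
      (hJ.of_injective (Submodule.inclusion inf_le_right) (Submodule.inclusion_injective _))
    exact congrArg Subtype.val
      (Subsingleton.elim (⟨x, hxI, hxJ⟩ : (I ⊓ J : Ideal A)) 0)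
  -- A proper sum would leave a simple quotient `L l` of `A / (I ⊔ J)`, but the image of every map
  -- `P l → A` already lies in `I` or in `J`.
  have htop : I ⊔ J = ⊤ := by
    by_contra hne
    have : Nontrivial (A ⧸ I ⊔ J) := Submodule.Quotient.nontrivial_iff.2 hne
    obtain ⟨l, g, hg⟩ := h.exists_surjective_of_finite (M := A ⧸ I ⊔ J)
    obtain ⟨f, hf⟩ := h.exists_ne_zero_of_surjective (g ∘ₗ (I ⊔ J).mkQ)
      (hg.comp (Submodule.mkQ_surjective _))
    have hfr : LinearMap.range f ≤ I ⊔ J := by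
      by_cases hl : l ∈ C
      · exact (hImax _ (h.isSupportedIn_range (hP l hl) f)).trans le_sup_left
      · exact (hJmax _ (h.isSupportedIn_range (hP' l hl) f)).trans le_sup_right
    refine hf ?_
    rw [LinearMap.comp_assoc, LinearMap.range_le_ker_iff.1 (hfr.trans (I ⊔ J).ker_mkQ.ge),
      LinearMap.comp_zero]
  obtain ⟨c, hc, d, hd, hcd⟩ := Submodule.mem_sup.1
    (show (1 : A) ∈ I ⊔ J from htop ▸ Submodule.mem_top)
  have hadd : ∀ {M : Type u} [AddCommGroup M] [Module A M] (x : M), c • x + d • x = x := by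
    intro M _ _ x
    rw [← add_smul, hcd, one_smul]
  have hIdm : ∀ x ∈ I, ∀ y ∈ J, x * y = 0 := fun x hx y hy =>
    hIJ _ (hIr x hx y) (J.mul_mem_left x hy)
  have hJdm : ∀ x ∈ J, ∀ y ∈ I, x * y = 0 := fun x hx y hy =>
    hIJ _ (I.mul_mem_left x hy) (hJr x hx y)
  have hc1 : ∀ a, a * c = c * a * c := fun a => by
    have := hadd (a * c)
    rw [smul_eq_mul, smul_eq_mul, hJdm d hd _ (I.mul_mem_left a hc), add_zero] at this
    rw [mul_assoc, this]
  have hc2 : ∀ a, c * a = c * a * c := fun a => by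
    have : c * a * (c + d) = c * a := by rw [hcd, mul_one]
    rwa [mul_add, hIdm _ (hIr c hc a) d hd, add_zero, eq_comm] at this
  refine ⟨c, Subring.mem_center_iff.2 fun a => (hc1 a).trans (hc2 a).symm, ?_, ?_, ?_⟩
  · have := hc1 1
    rw [one_mul, mul_one] at this
    exact this.symm
  · intro r hr x
    have h0 := h.hom_eq_zero_of_isSupportedIn hJ (by rw [compl_compl]; exact hP r hr)
      (LinearMap.toSpanSingleton A (P r) x ∘ₗ J.subtype)
    have hdx : d • x = 0 := LinearMap.congr_fun h0 ⟨d, hd⟩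
    have := hadd x
    rwa [hdx, add_zero] at this
  · intro r hr x
    have h0 := h.hom_eq_zero_of_isSupportedIn hI (hP' r hr)
      (LinearMap.toSpanSingleton A (P r) x ∘ₗ I.subtype)
    exact LinearMap.congr_fun h0 ⟨c, hc⟩

theorem nontrivial_projective (h : IsProjectiveLabelling L P) (l : W) : Nontrivial (P l) := by
  obtain ⟨π, hπ, -⟩ := h.exists_head l
  have := h.nontrivial_simple l
  exact hπ.nontrivial

/-- A central idempotent acts on `P l` as the identity or as zero. -/
theorem central_idempotent_smul (h : IsProjectiveLabelling L P) (l : W) {c : A}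
    (hc : c ∈ Subring.center A) (hci : IsIdempotentElem c) :
    (∀ x : P l, c • x = x) ∨ ∀ x : P l, c • x = 0 := by
  obtain ⟨π, hπ, hN⟩ := h.exists_head l
  have hd : 1 - c ∈ Subring.center A := Subring.sub_mem _ (Subring.one_mem _) hc
  by_cases h1 : LinearMap.range (centralSMul (P l) hc) = ⊤
  · left
    intro x
    obtain ⟨y, rfl⟩ := LinearMap.range_eq_top.1 h1 x
    change c • c • y = c • y
    rw [smul_smul, hci.eq]
  · right
    by_cases h2 : LinearMap.range (centralSMul (P l) hd) = ⊤
    · intro x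
      obtain ⟨y, rfl⟩ := LinearMap.range_eq_top.1 h2 x
      change c • (1 - c) • y = 0
      rw [smul_smul, mul_sub, mul_one, hci.eq, sub_self, zero_smul]
    · refine absurd (eq_top_iff.2 fun x _ => ?_) (h.ker_head_ne_top hπ)
      have hx : x = c • x + (1 - c) • x := by rw [← add_smul, add_sub_cancel, one_smul]
      rw [hx]
      exact add_mem (hN _ h1 ⟨x, rfl⟩) (hN _ h2 ⟨x, rfl⟩)

/-- Among central idempotents `c` acting as the identity on `P l`, one with `A c` minimal is
primitive: for a central idempotent `f` below it, either `f` or its complement in `e` again acts as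
the identity on `P l`. -/
theorem exists_block [IsArtinianRing A] (h : IsProjectiveLabelling L P) (l : W) :
    ∃ b : Block A, b.Contains (P l) := by
  let S : Set A := {c | c ∈ Subring.center A ∧ IsIdempotentElem c ∧ ∀ x : P l, c • x = x}
  obtain ⟨e, ⟨hec, hei, he1⟩, hmin⟩ :=
    (InvImage.wf (fun c : A => Ideal.span {c}) (wellFounded_lt (α := Ideal A))).has_min S
      ⟨1, Subring.one_mem _, IsIdempotentElem.one, one_smul A⟩
  have hS : ∀ g ∈ S, g * e = g → g = e := by
    intro g hg hge
    have hle : Ideal.span {g} ≤ Ideal.span {e} :=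
      (Ideal.span_singleton_le_iff_mem _).2 (Ideal.mem_span_singleton'.2 ⟨g, hge⟩)
    have heq : Ideal.span {g} = Ideal.span {e} := by
      by_contra hne
      exact hmin g hg (lt_of_le_of_ne hle hne)
    obtain ⟨a, ha⟩ := Ideal.mem_span_singleton'.1
      (heq ▸ Ideal.mem_span_singleton_self e : e ∈ Ideal.span {g})
    have : e * g = e := by rw [← ha, mul_assoc, hg.2.1.eq]
    rw [← hge, Subring.mem_center_iff.1 hec g, this]
  refine ⟨⟨e, hec, hei, ?_, fun f hfc hfi hfe => ?_⟩, he1⟩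
  · rintro rfl
    obtain ⟨x, hx⟩ := @exists_ne _ (h.nontrivial_projective l) 0
    exact hx (by rw [← he1 x, zero_smul])
  · rcases h.central_idempotent_smul l hfc hfi with h1 | h0
    · exact Or.inr (hS f ⟨hfc, hfi, h1⟩ hfe)
    · left
      have hef : e * f = f := by rw [← Subring.mem_center_iff.1 hec f, hfe]
      have hmem : e - f ∈ S := by
        refine ⟨Subring.sub_mem _ hec hfc, ?_, fun x => ?_⟩
        · rw [IsIdempotentElem, mul_sub, sub_mul, sub_mul, hei.eq, hfe, hef, hfi.eq, sub_self,
            sub_zero]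
        · rw [sub_smul, he1, h0, sub_zero]
      have := hS (e - f) hmem (by rw [sub_mul, hei.eq, hfe])
      exact sub_eq_self.1 this

/-- The nonzero left ideal `A e` belongs to the block of `e` and receives a nonzero map from some `P
l`. -/
theorem exists_contains_projective (h : IsProjectiveLabelling L P) [IsArtinianRing A]
    (b : Block A) : ∃ l, b.Contains (P l) := by
  obtain ⟨e, hec, hei, he0, hep⟩ := b
  have : Nontrivial (Ideal.span {e} : Ideal A) := Submodule.nontrivial_iff_ne_bot.2 (by
    rw [Ne, Ideal.span_singleton_eq_bot]
    exact he0)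
  obtain ⟨l, f, hf⟩ := h.exists_ne_zero (M := (Ideal.span {e} : Ideal A))
  refine ⟨l, ?_⟩
  obtain ⟨b, hb⟩ := h.exists_block l
  have hN : Block.Contains ⟨e, hec, hei, he0, hep⟩ (Ideal.span {e} : Ideal A) := by
    rintro ⟨x, hx⟩
    obtain ⟨a, rfl⟩ := Ideal.mem_span_singleton'.1 hx
    refine Subtype.ext ?_
    change e * (a * e) = a * e
    rw [← Subring.mem_center_iff.1 hec, mul_assoc, hei.eq]
  rwa [Block.eq_of_hom hb hN f hf] at hb

end IsProjectiveLabelling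

end Blocks

end QuasiHered

/-! ### The bijection between components and blocks. -/

open QuasiHered in
theorem propositionA1 {k : Type w} [Field k] {A : Type u} [Ring A] [Algebra k A]
    [Module.Finite k A] {W : Type v} [Finite W] [PartialOrder W]
    (L P : W → ModuleCat.{u} A)
    (hL : QuasiHered.IsSimpleLabelling L)
    (hP : ∀ l, QuasiHered.IsProjectiveCover A (P l) (L l))
    (hA : QuasiHered.IsQuasiHereditary L P)
    (D : QuasiHered.Duality A) (hD : D.SimplePreserving) :
    ∃ Φ : Quiver.WeaklyConnectedComponent (QuasiHered.HomQuiver k L P) ≃ QuasiHered.Block A,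
      ∀ l : W,
        (Φ (QuasiHered.homComponent k L P l)).Contains (L l) ∧
        (Φ (QuasiHered.homComponent k L P l)).Contains (QuasiHered.standard L P l) ∧
        (Φ (QuasiHered.homComponent k L P l)).Contains (P l) := by
  have h : IsProjectiveLabelling L P := ⟨hL, hP⟩
  have : IsNoetherianRing A := isNoetherian_of_tower k inferInstance
  have : IsArtinianRing A := isArtinian_of_tower k inferInstance
  choose b hb using h.exists_block
  have hstd : ∀ l, (b l).Contains (standard L P l) := fun l =>
    (hb l).of_surjective _ (standardKernel L P l).mkQ_surjective
  have hcongr : ∀ l m, homComponent k L P l = homComponent k L P m → b l = b m := fun l m =>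
    IsProjectiveLabelling.apply_eq_of_homComponent_eq b
      fun l m f hf => Block.eq_of_hom (hstd l) (hstd m) f hf
  have hinj : ∀ l m, b l = b m → homComponent k L P l = homComponent k L P m := by
    intro l m hlm
    by_contra hne
    obtain ⟨c, hc, hci, hc1, hc0⟩ := h.exists_central_idempotent
      (C := {r | homComponent k L P r = homComponent k L P l}) fun r s f hf => by
        rw [Set.mem_ofPred_eq, Set.mem_ofPred_eq, h.homComponent_eq_of_hom_projective hA hD f hf]
    have hcomm : (b l).1 * c = c * (b l).1 := Subring.mem_center_iff.1 hc _
    have hb1 : ∀ x : P l, (b l).1 • x = x := hb l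
    have hb2 : ∀ x : P m, (b l).1 • x = x := hlm ▸ hb m
    -- By primitivity `c` either kills the common block idempotent or fixes it; the first
    -- contradicts `c = 1` on `P l`, the second `c = 0` on `P m`.
    rcases (b l).2.2.2.2 (c * (b l).1) (Subring.mul_mem _ hc (b l).2.1)
      (hci.mul_of_commute hcomm.symm (b l).2.2.1) (by rw [mul_assoc, (b l).2.2.1.eq])
      with h0 | h1
    · obtain ⟨x, hx⟩ := @exists_ne _ (h.nontrivial_projective l) 0
      refine hx ?_
      rw [← hc1 l rfl x, ← hb1 x, smul_smul, h0, zero_smul]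
    · obtain ⟨x, hx⟩ := @exists_ne _ (h.nontrivial_projective m) 0
      refine hx ?_
      rw [← hb2 x, ← h1, mul_smul, hc0 m (fun h' => hne h'.symm)]
  let φ : Quiver.WeaklyConnectedComponent (HomQuiver k L P) → Block A :=
    Quotient.lift (s := Quiver.zigzagSetoid (HomQuiver k L P)) b
      fun l m hlm => hcongr l m (Quotient.sound hlm)
  have hφ : Function.Bijective φ := by
    constructor
    · intro x y
      induction x using Quotient.inductionOn with | h l
      induction y using Quotient.inductionOn with | h m
      exact hinj l m
    · intro b'
      obtain ⟨l, hl⟩ := h.exists_contains_projective b'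
      refine ⟨homComponent k L P l, ?_⟩
      obtain ⟨x, hx⟩ := @exists_ne _ (h.nontrivial_projective l) 0
      exact Block.eq_of_hom (hb l) hl LinearMap.id fun h0 => hx (LinearMap.congr_fun h0 x)
  refine ⟨Equiv.ofBijective φ hφ, fun l => ⟨?_, hstd l, hb l⟩⟩
  obtain ⟨π, hπ, -⟩ := h.exists_head l
  exact (hb l).of_surjective π hπ
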